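/- A \emph{polyomino} is a nonempty finite set of unit cells of the square lattice that is connected through edges of cells. It is \emph{convex} if every row and every column of it is connected. Let $n\ge 2$ and let $P$ be a polyomino without holes, with $n-1$ rows and $n-1$ columns, placed so that the south-west corner of its minimal bounding rectangle is the point $(1,1)$. Let $A_1,A_2,\dots,A_{2(r+1)}$ be the list of its vertices (the corners of its boundary) in clockwise order, starting from the leftmost vertex of minimal ordinate. $P$ is a \emph{permutomino of size $n$} if the points $A_1,A_3,\dots,A_{2r+1}$ are, in some order, the points $(j,\pi_1(j))$, $1\le j\le n$, of a permutation $\pi_1=\pi_1(P)\in\mathcal S_n$, and the points $A_2,A_4,\dots,A_{2r+2}$ are, in some order, the points $(j,\pi_2(j))$, $1\le j\le n$, of a permutation $\pi_2=\pi_2(P)\in\mathcal S_n$. By convention, the empty permutomino is a convex permutomino of size $1$, with $\pi_1=\pi_2=(1)$. For $\pi\in\mathcal S_n$, $n\geq 1$, let $\mu(\pi)$ be the sequence, read from left to right, of the entries $\pi(j)$ that are left-right maxima ($\pi(i)<\pi(j)$ for all $i<j$) or right-left maxima ($\pi(i)<\pi(j)$ for all $i>j$). Let $\sigma(\pi)$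 be the sequence, read from left to right, consisting of $\pi(1)$, of $\pi(n)$, and of all entries $\pi(j)$ with $1<j<n$ that do not occur in $\mu(\pi)$. A sequence $(s_1,\dots,s_r)$ is \emph{lower unimodal} if $s_1>s_2>\dots>s_k<s_{k+1}<\dots<s_r$ for some $1\le k\le r$. \textbf{Proposition.} Let $\pi\in\mathcal S_n$, $n\ge 1$. If $\pi=\pi_1(P)$ for some convex permutomino $P$ of size $n$, then the sequence $\sigma(\pi)$ is lower unimodal. -/

import Mathlib

namespace Permutomino

/-- Edge adjacency of unit cells of the square lattice. The pair `(x, y)` stands for the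
cell `[x, x + 1] × [y, y + 1]`. -/
def cellGraph : SimpleGraph (ℤ × ℤ) where
  Adj c d := |c.1 - d.1| + |c.2 - d.2| = 1
  symm := ⟨fun c d h => by rw [abs_sub_comm d.1, abs_sub_comm d.2]; exact h⟩
  loopless := ⟨fun c h => by simp at h⟩

/-- A polyomino: a nonempty finite set of cells that is connected through edges. -/
def IsPolyomino (P : Finset (ℤ × ℤ)) : Prop :=
  (cellGraph.induce (P : Set (ℤ × ℤ))).Connected

/-- No holes: the cells outside `P` are connected through edges. -/
def HasNoHoles (P : Finset (ℤ × ℤ)) : Prop :=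
  (cellGraph.induce (P : Set (ℤ × ℤ))ᶜ).Connected

/-- Every column of `P` is a contiguous block of cells. -/
def IsColumnConvex (P : Finset (ℤ × ℤ)) : Prop :=
  ∀ x : ℤ, {y : ℤ | (x, y) ∈ P}.OrdConnected

/-- Every row of `P` is a contiguous block of cells. -/
def IsRowConvex (P : Finset (ℤ × ℤ)) : Prop :=
  ∀ y : ℤ, {x : ℤ | (x, y) ∈ P}.OrdConnected

def IsConvex (P : Finset (ℤ × ℤ)) : Prop :=
  IsColumnConvex P ∧ IsRowConvex P

/-- `P` has `n` columns and `n` rows, and the south-west corner of its minimal bounding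
rectangle is the point `(1, 1)`. -/
def HasSquareBox (P : Finset (ℤ × ℤ)) (n : ℕ) : Prop :=
  P.image Prod.fst = Finset.Icc 1 (n : ℤ) ∧ P.image Prod.snd = Finset.Icc 1 (n : ℤ)

/-- The unit step from the lattice point `p` to the lattice point `q` is an edge of the boundary
of `P`, traversed clockwise: the cell on its right belongs to `P`, the cell on its left does not.
The four cases are the north, east, south and west steps. -/
def IsBoundaryStep (P : Finset (ℤ × ℤ)) (p q : ℤ × ℤ) : Prop :=
  (q = (p.1, p.2 + 1) ∧ (p.1, p.2) ∈ P ∧ (p.1 - 1, p.2) ∉ P) ∨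
  (q = (p.1 + 1, p.2) ∧ (p.1, p.2 - 1) ∈ P ∧ (p.1, p.2) ∉ P) ∨
  (q = (p.1, p.2 - 1) ∧ (p.1 - 1, p.2 - 1) ∈ P ∧ (p.1, p.2 - 1) ∉ P) ∨
  (q = (p.1 - 1, p.2) ∧ (p.1 - 1, p.2) ∈ P ∧ (p.1 - 1, p.2 - 1) ∉ P)

/-- `a` and `b` are the ends of a nondegenerate vertical segment. -/
def IsVertical (a b : ℤ × ℤ) : Prop := a.1 = b.1 ∧ a.2 ≠ b.2

/-- `a` and `b` are the ends of a nondegenerate horizontal segment. -/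
def IsHorizontal (a b : ℤ × ℤ) : Prop := a.2 = b.2 ∧ a.1 ≠ b.1

/-- The unit step from `p` to `q` is one of the steps that make up the axis-parallel segment from
`a` to `b`, traversed from `a` to `b` (north, south, east and west cases). -/
def IsStepOf (a b p q : ℤ × ℤ) : Prop :=
  (a.1 = b.1 ∧ p.1 = a.1 ∧ q.1 = a.1 ∧
    ((q.2 = p.2 + 1 ∧ a.2 ≤ p.2 ∧ q.2 ≤ b.2) ∨ (q.2 = p.2 - 1 ∧ p.2 ≤ a.2 ∧ b.2 ≤ q.2))) ∨
  (a.2 = b.2 ∧ p.2 = a.2 ∧ q.2 = a.2 ∧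
    ((q.1 = p.1 + 1 ∧ a.1 ≤ p.1 ∧ q.1 ≤ b.1) ∨ (q.1 = p.1 - 1 ∧ p.1 ≤ a.1 ∧ b.1 ≤ q.1)))

/-- `A 0, A 1, …, A (N - 1)` is the list of the vertices (corners of the boundary) of `P`, in
clockwise order, starting from the leftmost vertex of minimal ordinate. The indices are cyclic:
`A (N - 1)` is followed by `A 0`. -/
structure IsVertexList (P : Finset (ℤ × ℤ)) {N : ℕ} [NeZero N] (A : Fin N → ℤ × ℤ) : Prop where
  /-- the list starts at the leftmost of the lowest vertices -/
  start : ∀ i, (A 0).2 < (A i).2 ∨ ((A 0).2 = (A i).2 ∧ (A 0).1 ≤ (A i).1)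
  /-- the sides that meet at a listed point are perpendicular, so that it is a corner -/
  corner : ∀ i,
    (IsVertical (A i) (A (i + 1)) ∧ IsHorizontal (A (i + 1)) (A (i + 1 + 1))) ∨
    (IsHorizontal (A i) (A (i + 1)) ∧ IsVertical (A (i + 1)) (A (i + 1 + 1)))
  /-- the sides run clockwise along the boundary -/
  boundary : ∀ i p q, IsStepOf (A i) (A (i + 1)) p q → IsBoundaryStep P p q
  /-- the whole boundary is traversed, exactly once -/
  once : ∀ p q, IsBoundaryStep P p q → ∃! i, IsStepOf (A i) (A (i + 1)) p q

/-- The (pairwise distinct) points `Q i` are the points `(j, π(j))`, `1 ≤ j ≤ m`. Here `Fin m`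
is `0, …, m - 1`, so that all coordinates are shifted by one. -/
def Represents {ι : Type} (Q : ι → ℤ × ℤ) {m : ℕ} (π : Equiv.Perm (Fin m)) : Prop :=
  Function.Injective Q ∧
    Set.range Q = Set.range fun j : Fin m => (((j : ℕ) : ℤ) + 1, ((π j : ℕ) : ℤ) + 1)

/-- `P` is a permutomino of size `m` with `π₁(P) = π₁` and `π₂(P) = π₂`: either `P` is the empty
permutomino of size `1`, or `P` is a polyomino without holes with `m - 1 ≥ 1` rows and columns,
such that, in the list `A₁, A₂, …, A_{2(r+1)}` of its vertices, the points `A₁, A₃, …`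
represent `π₁` and the points `A₂, A₄, …` represent `π₂`. (`A i` is `A_{i+1}`.) -/
def IsPermutomino (P : Finset (ℤ × ℤ)) {m : ℕ} (π₁ π₂ : Equiv.Perm (Fin m)) : Prop :=
  (P = ∅ ∧ m = 1) ∨
  (2 ≤ m ∧ IsPolyomino P ∧ HasNoHoles P ∧ HasSquareBox P (m - 1) ∧
    ∃ (r : ℕ) (A : Fin (2 * (r + 1)) → ℤ × ℤ), IsVertexList P A ∧
      Represents (fun i : Fin (r + 1) => A ⟨2 * i, by omega⟩) π₁ ∧
      Represents (fun i : Fin (r + 1) => A ⟨2 * i + 1, by omega⟩) π₂)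

/-- `π` is (`π₁`-)associated with a convex permutomino. -/
def IsConvexAssociated {m : ℕ} (π : Equiv.Perm (Fin m)) : Prop :=
  ∃ (P : Finset (ℤ × ℤ)) (π₂ : Equiv.Perm (Fin m)), IsConvex P ∧ IsPermutomino P π π₂

abbrev IsLeftRightMax {m : ℕ} (π : Equiv.Perm (Fin m)) (j : Fin m) : Prop :=
  ∀ i, i < j → π i < π j

abbrev IsRightLeftMax {m : ℕ} (π : Equiv.Perm (Fin m)) (j : Fin m) : Prop :=
  ∀ i, j < i → π i < π j

/-- The sequence `μ(π)`: the left-right maxima of `π`, up to the maximal entry, followed by the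
right-left maxima, read from left to right. Entries are numbered from `1` to `m`. -/
def mu {m : ℕ} (π : Equiv.Perm (Fin m)) : List ℕ :=
  ((List.finRange m).filter fun j : Fin m => IsLeftRightMax π j ∨ IsRightLeftMax π j).map
    fun j => (π j : ℕ) + 1

/-- The sequence `σ(π)`: the first entry of `π`, the last entry of `π`, and between them the
entries that do not occur in `μ(π)`, read from left to right. -/
def sigma {m : ℕ} (π : Equiv.Perm (Fin m)) : List ℕ :=
  ((List.finRange m).filter fun j : Fin m =>
      (j : ℕ) = 0 ∨ (j : ℕ) + 1 = m ∨ (π j : ℕ) + 1 ∉ mu π).map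
    fun j => (π j : ℕ) + 1

/-- A sequence `s₁ > s₂ > ⋯ > s_k < ⋯ < s_r`, with `1 ≤ k ≤ r`. -/
def IsLowerUnimodal (s : List ℕ) : Prop :=
  ∃ (l : List ℕ) (a : ℕ) (l' : List ℕ), s = l ++ a :: l' ∧
    (l ++ [a]).Pairwise (· > ·) ∧ (a :: l').Pairwise (· < ·)

end Permutomino

namespace Permutomino

/-! If `sigma π` were not lower unimodal, it would contain a peak x < y > z. Its middle entry is
neither first nor last in `π`, so it is absent from `mu π` and has larger entries on both sides.
With x and z, the vertex carrying y then has vertices in all four open quadrants. Each of these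
touches a cell of `P`, while the central vertex touches a cell outside `P`. By convexity this
missing cell blocks a vertical and a horizontal ray; by connectedness `P` cannot cross them, so it
misses a quadrant (`IsConvex.false_of_quadrants_nonempty`). -/

/-- A set of lattice cells that contains a cell of `P` and cannot be left along an edge inside `P`
contains the polyomino `P`. -/
theorem IsPolyomino.subset_of_closed {P : Finset (ℤ × ℤ)} (hP : IsPolyomino P) {S : Set (ℤ × ℤ)}
    (hS : ∀ c ∈ P, ∀ d ∈ P, cellGraph.Adj c d → c ∈ S → d ∈ S) {c : ℤ × ℤ} (hc : c ∈ P)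
    (hcS : c ∈ S) {d : ℤ × ℤ} (hd : d ∈ P) : d ∈ S := by
  obtain ⟨w⟩ := hP.preconnected ⟨c, hc⟩ ⟨d, hd⟩
  have key : ∀ u v : (P : Set (ℤ × ℤ)), (cellGraph.induce (P : Set (ℤ × ℤ))).Walk u v →
      u.1 ∈ S → v.1 ∈ S := by
    intro u v w
    induction w with
    | nil => exact id
    | @cons u v _ h _ ih => exact fun hu => ih (hS u.1 u.2 v.1 v.2 h hu)
  exact key _ _ w hcS

/-- The four neighbours of a cell. -/
theorem cellGraph_adj_cases {c d : ℤ × ℤ} (h : cellGraph.Adj c d) :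
    (d.1 = c.1 ∧ (d.2 = c.2 + 1 ∨ d.2 = c.2 - 1)) ∨
      (d.2 = c.2 ∧ (d.1 = c.1 + 1 ∨ d.1 = c.1 - 1)) := by
  have h' : |c.1 - d.1| + |c.2 - d.2| = 1 := h
  rcases abs_cases (c.1 - d.1) with h1 | h1 <;> rcases abs_cases (c.2 - d.2) with h2 | h2 <;> omega

/-- A convex polyomino that meets all four closed quadrants at a cell contains that cell. -/
theorem IsConvex.false_of_quadrants_nonempty {P : Finset (ℤ × ℤ)} (hP : IsPolyomino P)
    (hc : IsConvex P) {x y : ℤ} (hxy : (x, y) ∉ P)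
    (hne : ∃ c ∈ P, x ≤ c.1 ∧ y ≤ c.2) (hnw : ∃ c ∈ P, c.1 ≤ x ∧ y ≤ c.2)
    (hsw : ∃ c ∈ P, c.1 ≤ x ∧ c.2 ≤ y) (hse : ∃ c ∈ P, x ≤ c.1 ∧ c.2 ≤ y) : False := by
  obtain ⟨⟨a₁, b₁⟩, hP₁, h₁, h₁'⟩ := hne
  obtain ⟨⟨a₂, b₂⟩, hP₂, h₂, h₂'⟩ := hnw
  obtain ⟨⟨a₃, b₃⟩, hP₃, h₃, h₃'⟩ := hsw
  obtain ⟨⟨a₄, b₄⟩, hP₄, h₄, h₄'⟩ := hse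
  dsimp only at h₁ h₁' h₂ h₂' h₃ h₃' h₄ h₄'
  -- Cells of `P` both above and below the missing cell would force it into `P`, so a half-column is
  -- empty; likewise a half-row.
  have col : (∀ b, y ≤ b → (x, b) ∉ P) ∨ (∀ b, b ≤ y → (x, b) ∉ P) := by
    by_contra! h
    obtain ⟨⟨b, hb, hbP⟩, b', hb', hbP'⟩ := h
    exact hxy ((hc.1 x).out hbP' hbP ⟨hb', hb⟩)
  have row : (∀ a, x ≤ a → (a, y) ∉ P) ∨ (∀ a, a ≤ x → (a, y) ∉ P) := by
    by_contra! h
    obtain ⟨⟨a, ha, haP⟩, a', ha', haP'⟩ := h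
    exact hxy ((hc.2 y).out haP' haP ⟨ha', ha⟩)
  rcases col with col | col <;> rcases row with row | row
  -- The closed quadrant bounded by the two empty rays can only be left from a cell on one of them,
  -- so it contains `P`. It meets the opposite quadrant in (x, y) alone. The other three cases are
  -- symmetric.
  · have := hP.subset_of_closed (S := {c | x ≤ c.1 ∧ y ≤ c.2}) ?_ hP₁ ⟨h₁, h₁'⟩ hP₃
    · obtain ⟨h5, h6⟩ := this
      dsimp only at h5 h6
      obtain rfl : a₃ = x := by omega
      obtain rfl : b₃ = y := by omega
      exact hxy hP₃
    · rintro ⟨a, b⟩ hab ⟨a', b'⟩ - hadj ⟨h5, h6⟩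
      have h7 := cellGraph_adj_cases hadj
      dsimp only at h5 h6 h7
      have h8 : a ≠ x := by rintro rfl; exact col _ h6 hab
      have h9 : b ≠ y := by rintro rfl; exact row _ h5 hab
      constructor <;> dsimp only <;> omega
  · have := hP.subset_of_closed (S := {c | c.1 ≤ x ∧ y ≤ c.2}) ?_ hP₂ ⟨h₂, h₂'⟩ hP₄
    · obtain ⟨h5, h6⟩ := this
      dsimp only at h5 h6
      obtain rfl : a₄ = x := by omega
      obtain rfl : b₄ = y := by omega
      exact hxy hP₄
    · rintro ⟨a, b⟩ hab ⟨a', b'⟩ - hadj ⟨h5, h6⟩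
      have h7 := cellGraph_adj_cases hadj
      dsimp only at h5 h6 h7
      have h8 : a ≠ x := by rintro rfl; exact col _ h6 hab
      have h9 : b ≠ y := by rintro rfl; exact row _ h5 hab
      constructor <;> dsimp only <;> omega
  · have := hP.subset_of_closed (S := {c | x ≤ c.1 ∧ c.2 ≤ y}) ?_ hP₄ ⟨h₄, h₄'⟩ hP₂
    · obtain ⟨h5, h6⟩ := this
      dsimp only at h5 h6
      obtain rfl : a₂ = x := by omega
      obtain rfl : b₂ = y := by omega
      exact hxy hP₂
    · rintro ⟨a, b⟩ hab ⟨a', b'⟩ - hadj ⟨h5, h6⟩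
      have h7 := cellGraph_adj_cases hadj
      dsimp only at h5 h6 h7
      have h8 : a ≠ x := by rintro rfl; exact col _ h6 hab
      have h9 : b ≠ y := by rintro rfl; exact row _ h5 hab
      constructor <;> dsimp only <;> omega
  · have := hP.subset_of_closed (S := {c | c.1 ≤ x ∧ c.2 ≤ y}) ?_ hP₃ ⟨h₃, h₃'⟩ hP₁
    · obtain ⟨h5, h6⟩ := this
      dsimp only at h5 h6
      obtain rfl : a₁ = x := by omega
      obtain rfl : b₁ = y := by omega
      exact hxy hP₁
    · rintro ⟨a, b⟩ hab ⟨a', b'⟩ - hadj ⟨h5, h6⟩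
      have h7 := cellGraph_adj_cases hadj
      dsimp only at h5 h6 h7
      have h8 : a ≠ x := by rintro rfl; exact col _ h6 hab
      have h9 : b ≠ y := by rintro rfl; exact row _ h5 hab
      constructor <;> dsimp only <;> omega

/-- The cell `c` has the lattice point `p` as a corner. -/
def IsIncident (p c : ℤ × ℤ) : Prop :=
  (p.1 - 1 ≤ c.1 ∧ c.1 ≤ p.1) ∧ (p.2 - 1 ≤ c.2 ∧ c.2 ≤ p.2)

/-- The origin of a boundary step is a corner of a cell of `P` and of a cell outside `P`. -/
theorem IsBoundaryStep.exists_incident {P : Finset (ℤ × ℤ)} {p q : ℤ × ℤ}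
    (h : IsBoundaryStep P p q) :
    (∃ c ∈ P, IsIncident p c) ∧ ∃ c ∉ P, IsIncident p c := by
  rcases h with ⟨-, h, h'⟩ | ⟨-, h, h'⟩ | ⟨-, h, h'⟩ | ⟨-, h, h'⟩ <;>
    exact ⟨⟨_, h, by simp [IsIncident]⟩, ⟨_, h', by simp [IsIncident]⟩⟩

/-- A side of the boundary has a first unit step. -/
theorem exists_isStepOf {a b : ℤ × ℤ} (h : IsVertical a b ∨ IsHorizontal a b) :
    ∃ q, IsStepOf a b a q := by
  rcases h with ⟨h, h'⟩ | ⟨h, h'⟩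
  · rcases lt_or_gt_of_ne h' with h' | h'
    · exact ⟨(a.1, a.2 + 1), Or.inl ⟨h, rfl, rfl, Or.inl ⟨rfl, le_rfl, h'⟩⟩⟩
    · exact ⟨(a.1, a.2 - 1), Or.inl ⟨h, rfl, rfl, Or.inr ⟨rfl, le_rfl, by dsimp only; omega⟩⟩⟩
  · rcases lt_or_gt_of_ne h' with h' | h'
    · exact ⟨(a.1 + 1, a.2), Or.inr ⟨h, rfl, rfl, Or.inl ⟨rfl, le_rfl, h'⟩⟩⟩
    · exact ⟨(a.1 - 1, a.2), Or.inr ⟨h, rfl, rfl, Or.inr ⟨rfl, le_rfl, by dsimp only; omega⟩⟩⟩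

theorem IsVertexList.exists_incident {P : Finset (ℤ × ℤ)} {N : ℕ} [NeZero N]
    {A : Fin N → ℤ × ℤ} (hA : IsVertexList P A) (i : Fin N) :
    (∃ c ∈ P, IsIncident (A i) c) ∧ ∃ c ∉ P, IsIncident (A i) c := by
  obtain ⟨q, hq⟩ := exists_isStepOf ((hA.corner i).imp And.left And.left)
  exact (hA.boundary i _ q hq).exists_incident

/-- No boundary point of a convex polyomino has boundary points in all four open quadrants: every
entry of the permutation is an extreme one in at least one of the four directions. -/
theorem IsConvexAssociated.not_interior {m : ℕ} {π : Equiv.Perm (Fin m)}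
    (hπ : IsConvexAssociated π) {j i i' k k' : Fin m} (hi : i < j) (hi' : i' < j) (hk : j < k)
    (hk' : j < k') (hij : π i < π j) (hij' : π j < π i') (hkj : π k < π j)
    (hkj' : π j < π k') : False := by
  obtain ⟨P, π₂, hconv, ⟨-, rfl⟩ | ⟨-, hP, -, -, r, A, hA, hπ₁, -⟩⟩ := hπ
  · omega
  · have hinc : ∀ j : Fin m,
        (∃ c ∈ P, IsIncident (((j : ℕ) : ℤ) + 1, ((π j : ℕ) : ℤ) + 1) c) ∧
          ∃ c ∉ P, IsIncident (((j : ℕ) : ℤ) + 1, ((π j : ℕ) : ℤ) + 1) c := by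
      intro j
      obtain ⟨t, ht⟩ : (((j : ℕ) : ℤ) + 1, ((π j : ℕ) : ℤ) + 1) ∈
          Set.range fun i : Fin (r + 1) => A ⟨2 * i, by omega⟩ := by
        rw [hπ₁.2]
        exact Set.mem_range_self j
      rw [← ht]
      exact hA.exists_incident _
    -- Incident cells are offset from a point by 0 or -1 in each coordinate, so strict inequalities
    -- between points become weak ones between cells. The witnesses below lie to the NE, NW, SW and
    -- SE.
    obtain ⟨-, ⟨x, y⟩, hxy, h⟩ := hinc j
    obtain ⟨⟨c₁, hc₁, h₁⟩, -⟩ := hinc k'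
    obtain ⟨⟨c₂, hc₂, h₂⟩, -⟩ := hinc i'
    obtain ⟨⟨c₃, hc₃, h₃⟩, -⟩ := hinc i
    obtain ⟨⟨c₄, hc₄, h₄⟩, -⟩ := hinc k
    simp only [IsIncident] at h h₁ h₂ h₃ h₄
    rw [Fin.lt_def] at hi hi' hk hk' hij hij' hkj hkj'
    refine hconv.false_of_quadrants_nonempty hP hxy ⟨c₁, hc₁, ?_⟩ ⟨c₂, hc₂, ?_⟩ ⟨c₃, hc₃, ?_⟩
      ⟨c₄, hc₄, ?_⟩ <;> omega

/-- A nonempty sequence of distinct numbers without a peak `x < y > z` is lower unimodal. -/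
theorem isLowerUnimodal_of_no_peak {l : List ℕ} (hl : l ≠ []) (hd : l.Nodup)
    (h : ∀ x y z, [x, y, z].Sublist l → x < y → y < z ∨ y = z) : IsLowerUnimodal l := by
  induction l with
  | nil => exact absurd rfl hl
  | cons a t ih =>
    rcases t with _ | ⟨b, t⟩
    · exact ⟨[], a, [], by simp⟩
    · have hab : a ≠ b := by rintro rfl; simp at hd
      rcases lt_or_gt_of_ne hab with hab | hab
      -- After an initial ascent the minimum is `a`: every later entry exceeds `a`, so a later
      -- descent would form a peak with it.
      · refine ⟨[], a, b :: t, rfl, by simp, ?_⟩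
        have hlt : ∀ x ∈ b :: t, a < x := by
          intro x hx
          rcases List.mem_cons.1 hx with rfl | hx
          · exact hab
          · have := h a b x (((List.singleton_sublist.2 hx).cons_cons b).cons_cons a) hab
            omega
        refine List.pairwise_cons.2 ⟨hlt, ?_⟩
        rw [List.pairwise_iff_forall_sublist]
        intro x y hxy
        have hne : x ≠ y := List.pairwise_iff_forall_sublist.1 (List.nodup_cons.1 hd).2 hxy
        have := h a x y (hxy.cons_cons a) (hlt x (hxy.subset (by simp)))
        omega
      · obtain ⟨u, c, v, huv, hu, hv⟩ := ih (by simp) (List.nodup_cons.1 hd).2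
          fun x y z hs => h x y z (hs.cons a)
        refine ⟨a :: u, c, v, by simp [huv], ?_, hv⟩
        rw [List.cons_append, List.pairwise_cons]
        refine ⟨?_, hu⟩
        -- `b` is the bottom `c` if the descending arm `u` is empty, and its head otherwise; either
        -- way `a` exceeds the whole arm.
        rcases u with _ | ⟨d, u⟩
        · simp only [List.nil_append, List.cons.injEq] at huv
          intro x hx
          simp only [List.nil_append, List.mem_singleton] at hx
          omega
        · simp only [List.cons_append, List.cons.injEq] at huv
          rw [List.cons_append, List.pairwise_cons] at hu
          intro x hx
          rw [List.cons_append, List.mem_cons] at hx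
          rcases hx with rfl | hx
          · omega
          · have := hu.1 x hx
            omega

/-- An interior entry that does not occur in `μ(π)` has larger entries on both sides. -/
theorem exists_lt_of_notMem_mu {m : ℕ} {π : Equiv.Perm (Fin m)} {j : Fin m}
    (h : (π j : ℕ) + 1 ∉ mu π) : (∃ i < j, π j < π i) ∧ ∃ k > j, π j < π k := by
  have hj : ¬ (IsLeftRightMax π j ∨ IsRightLeftMax π j) := fun hj =>
    h (List.mem_map.2 ⟨j, List.mem_filter.2 ⟨List.mem_finRange j, by simpa using hj⟩, rfl⟩)
  rw [not_or] at hj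
  obtain ⟨h₁, h₂⟩ := hj
  unfold IsLeftRightMax at h₁
  unfold IsRightLeftMax at h₂
  push Not at h₁ h₂
  obtain ⟨i, hi, hi'⟩ := h₁
  obtain ⟨k, hk, hk'⟩ := h₂
  exact ⟨⟨i, hi, lt_of_le_of_ne hi' fun e => hi.ne' (π.injective e)⟩,
    ⟨k, hk, lt_of_le_of_ne hk' fun e => hk.ne (π.injective e)⟩⟩

end Permutomino

theorem mainTheorem12 {n : ℕ} (π : Equiv.Perm (Fin n))
    (hπ : Permutomino.IsConvexAssociated π) :
    Permutomino.IsLowerUnimodal (Permutomino.sigma π) := by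
  have hn : 0 < n := by
    obtain ⟨P, π₂, -, ⟨-, rfl⟩ | ⟨h, -⟩⟩ := hπ <;> omega
  have hinj : Function.Injective fun j : Fin n => (π j : ℕ) + 1 := fun a b h =>
    π.injective (Fin.ext (Nat.succ_injective h))
  apply Permutomino.isLowerUnimodal_of_no_peak
  · refine List.ne_nil_of_mem (a := (π ⟨0, hn⟩ : ℕ) + 1) (List.mem_map.2 ⟨⟨0, hn⟩, ?_, rfl⟩)
    simp
  · exact ((List.nodup_finRange n).filter _).map hinj
  · intro x y z hs hxy
    obtain ⟨l, hl, hxyz⟩ := List.sublist_map_iff.1 hs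
    obtain ⟨i, j, k, rfl⟩ : ∃ i j k, l = [i, j, k] :=
      List.length_eq_three.1 (by simpa using (congrArg List.length hxyz).symm)
    simp only [List.map_cons, List.map_nil, List.cons.injEq, and_true] at hxyz
    obtain ⟨rfl, rfl, rfl⟩ := hxyz
    have hlt := (List.pairwise_lt_finRange n).sublist (hl.trans List.filter_sublist)
    simp only [List.pairwise_cons, List.mem_cons, List.not_mem_nil, or_false, forall_eq_or_imp,
      forall_eq] at hlt
    obtain ⟨⟨hij, -⟩, hjk, -⟩ := hlt
    have hj := (List.mem_filter.1 (hl.subset (by simp : j ∈ [i, j, k]))).2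
    rw [decide_eq_true_eq] at hj
    rw [← le_iff_lt_or_eq]
    by_contra! hzy
    -- Lying strictly between `i` and `k`, `j` is not an end position, which leaves only the third
    -- clause of the filter.
    have hmu : (π j : ℕ) + 1 ∉ Permutomino.mu π := by
      rw [Fin.lt_def] at hij hjk
      rcases hj with hj | hj | hj
      · omega
      · omega
      · exact hj
    obtain ⟨⟨i', hi', hi''⟩, k', hk', hk''⟩ := Permutomino.exists_lt_of_notMem_mu hmu
    exact hπ.not_interior hij hi' hjk hk' (by rw [Fin.lt_def]; omega) hi''
      (by rw [Fin.lt_def]; omega) hk''
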